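/- Let $i\in\{3\tfrac12,4,5\}$, where a $T_{3\frac12}$-space is a completely regular Hausdorff space, a $T_4$-space is a normal $T_1$-space, and a $T_5$-space is a hereditarily normal $T_1$-space. A $T_i$ one-point connectification of a space $X$ is a connected $T_i$-space which contains $X$ as a dense subspace and whose set of points outside $X$ is a singleton; two of them are identified if there is a homeomorphism between them fixing every point of $X$. Let $\mathscr{Y}_i(X)$ be the set of all $T_i$ one-point connectifications of $X$ (up to this identification), partially ordered by: $Y_1\le Y_2$ if there is a continuous map $Y_2\to Y_1$ fixing every point of $X$. Write $\beta C$ for the Stone–Čech compactification of $C$. Let $X$ and $Y$ be locally connected, locally compact $T_i$-spaces such that $\beta C\setminus C$ has at least $3$ points for every connected component $C$ of $X$ and for every connected component $C$ of $Y$. If the partially ordered sets $\mathscr{Y}_i(X)$ and $\mathscr{Y}_i(Y)$ are order-isomorphic, then there is a bijection $C\mapsto C_\psi$ from the set of components of $X$ onto the set of components of $Y$ such that, for every component $C$ of $X$, the spaces $\beta C\setminus C$ and $\beta C_\psi\setminus C_\psi$ are homeomorphic. -/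

import Mathlib

open Topology

universe u v

/-- The indices `i = 3½, 4, 5` of the separation properties that are considered. -/
inductive SepIndex : Type
  | threeHalf
  | four
  | five

/-- `SepIndex.IsT i X` says that `X` is a `T_i`-space: `T_{3½}` means completely regular and
Hausdorff, `T_4` means `T_1` and normal, `T_5` means `T_1` and hereditarily (completely) normal. -/
def SepIndex.IsT (i : SepIndex) (X : Type u) [TopologicalSpace X] : Prop :=
  match i with
  | .threeHalf => T35Space X
  | .four => T4Space X
  | .five => T5Space X

theorem SepIndex.IsT.t2Space {i : SepIndex} {X : Type u} [TopologicalSpace X] (h : i.IsT X) :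
    T2Space X := by
  cases i
  · have : T35Space X := h
    infer_instance
  · have : T4Space X := h
    infer_instance
  · have : T5Space X := h
    infer_instance

/-- A `T_i` one-point connectification of `X`: a connected `T_i`-space containing `X` (through the
embedding `incl`) as a dense subspace whose complement is a singleton. Since such a space has just
one point more than `X`, each one (in any universe) is homeomorphic over `X` to one in the universe
of `X`. -/
structure OnePointConnectification (i : SepIndex) (X : Type u) [TopologicalSpace X] where
  carrier : Type u
  [top : TopologicalSpace carrier]
  incl : X → carrier
  isEmbedding_incl : IsEmbedding incl
  denseRange_incl : DenseRange incl
  compl_range_incl : ∃ p : carrier, (Set.range incl)ᶜ = {p}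
  connectedSpace : ConnectedSpace carrier
  isT : i.IsT carrier

attribute [instance] OnePointConnectification.top

namespace OnePointConnectification

variable {i : SepIndex} {X : Type u} [TopologicalSpace X]

/-- Two one-point connectifications are equivalent if there is a homeomorphism between them
which fixes the points of `X`. -/
def Equivalent (Y Z : OnePointConnectification i X) : Prop :=
  ∃ h : Y.carrier ≃ₜ Z.carrier, ∀ x : X, h (Y.incl x) = Z.incl x

/-- `Y.Below Z` says that there is a continuous map from `Z` to `Y` fixing the points of `X`. -/
def Below (Y Z : OnePointConnectification i X) : Prop :=
  ∃ f : Z.carrier → Y.carrier, Continuous f ∧ ∀ x : X, f (Z.incl x) = Y.incl x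

theorem equivalence_equivalent :
    Equivalence (Equivalent : OnePointConnectification i X → _ → Prop) where
  refl Y := ⟨Homeomorph.refl _, fun _ => rfl⟩
  symm := by
    rintro Y Z ⟨h, hh⟩
    exact ⟨h.symm, fun x => by rw [← hh x, h.symm_apply_apply]⟩
  trans := by
    rintro Y Z W ⟨h, hh⟩ ⟨k, hk⟩
    exact ⟨h.trans k, fun x => by rw [Homeomorph.trans_apply, hh, hk]⟩

theorem Equivalent.below {Y Z : OnePointConnectification i X} (h : Y.Equivalent Z) :
    Y.Below Z := by
  obtain ⟨h, hh⟩ := h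
  exact ⟨h.symm, h.symm.continuous, fun x => by rw [← hh x, h.symm_apply_apply]⟩

theorem Below.trans {Y Z W : OnePointConnectification i X} (h : Y.Below Z) (k : Z.Below W) :
    Y.Below W := by
  obtain ⟨f, hf, hfx⟩ := h
  obtain ⟨g, hg, hgx⟩ := k
  exact ⟨f ∘ g, hf.comp hg, fun x => by rw [Function.comp_apply, hgx, hfx]⟩

theorem Below.antisymm {Y Z : OnePointConnectification i X} (h : Y.Below Z) (k : Z.Below Y) :
    Y.Equivalent Z := by
  obtain ⟨f, hf, hfx⟩ := h
  obtain ⟨g, hg, hgx⟩ := k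
  have : T2Space Y.carrier := Y.isT.t2Space
  have : T2Space Z.carrier := Z.isT.t2Space
  have h₁ : f ∘ g = id := Y.denseRange_incl.equalizer (hf.comp hg) continuous_id
    (funext fun x => by simp [hgx, hfx])
  have h₂ : g ∘ f = id := Z.denseRange_incl.equalizer (hg.comp hf) continuous_id
    (funext fun x => by simp [hgx, hfx])
  exact ⟨⟨⟨g, f, congrFun h₁, congrFun h₂⟩, hg, hf⟩, hgx⟩

instance setoid (i : SepIndex) (X : Type u) [TopologicalSpace X] :
    Setoid (OnePointConnectification i X) :=
  ⟨Equivalent, equivalence_equivalent⟩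

end OnePointConnectification

/-- The set of all `T_i` one-point connectifications of `X`, up to equivalence. -/
def ConnectificationPoset (i : SepIndex) (X : Type u) [TopologicalSpace X] : Type (u + 1) :=
  Quotient (OnePointConnectification.setoid i X)

/-- `Y ≤ Z` if there is a continuous map from `Z` to `Y` fixing the points of `X`. -/
instance (i : SepIndex) (X : Type u) [TopologicalSpace X] :
    PartialOrder (ConnectificationPoset i X) where
  le := Quotient.lift₂ OnePointConnectification.Below fun _ _ _ _ h k =>
    propext ⟨fun b => ((Setoid.symm h).below.trans b).trans (OnePointConnectification.Equivalent.below k),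
      fun b => ((OnePointConnectification.Equivalent.below h).trans b).trans (Setoid.symm k).below⟩
  le_refl := by
    rintro ⟨Y⟩
    exact OnePointConnectification.Equivalent.below (Setoid.refl Y)
  le_trans := by
    rintro ⟨Y⟩ ⟨Z⟩ ⟨W⟩ h k
    exact OnePointConnectification.Below.trans h k
  le_antisymm := by
    rintro ⟨Y⟩ ⟨Z⟩ h k
    exact Quotient.sound (OnePointConnectification.Below.antisymm h k)

/-- The set of connected components of `X`, as subsets of `X`. -/
def Component (X : Type u) [TopologicalSpace X] : Type u :=
  {C : Set X // ∃ x : X, C = connectedComponent x}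

/-- The Stone–Čech remainder `βX ∖ X`, with the subspace topology. -/
abbrev StoneCechRemainder (X : Type u) [TopologicalSpace X] : Type u :=
  {p : StoneCech X // p ∉ Set.range (stoneCechUnit : X → StoneCech X)}

/-! A one-point connectification `Z` leaves on each component `C` a trace: the points of `βC ∖ C`
that the neighbourhoods of the added point cluster at. Traces are closed, and nonempty because `Z`
is connected. Conversely, every family `b` of nonempty closed sets `b C ⊆ βC ∖ C` is the family of
traces of a connectification `box b`, whose neighbourhoods of the added point are chosen
independently on the components. Complete regularity of `Z` gives `Z ≤ box b` iff each `b C` lies in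
the trace of `Z` on `C` (`below_box_iff`).

Hence, for nonempty `X`, the maximal elements are the points of `∏ (βC ∖ C)`, and the sets of
maximal elements above a given element are exactly the closed boxes. An order isomorphism thus
induces a bijection of products preserving closed boxes both ways. Two-point boxes detect pairs
differing in one coordinate, so lines go to lines; their directions match the components, and closed
boxes inside a line recover the topology of its factor. -/

open Set Function

/-! ### Bijections of products that preserve closed boxes -/

section ClosedBoxes

/-- A closed box in a product is a product of nonempty closed subsets of the factors. -/
def IsClosedBox {ι : Type*} {R : ι → Type*} [∀ i, TopologicalSpace (R i)]
    (A : Set (∀ i, R i)) : Prop :=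
  ∃ b : ∀ i, Set (R i), (∀ i, IsClosed (b i) ∧ (b i).Nonempty) ∧ A = univ.pi b

variable {ι κ : Type*} {R : ι → Type*} {S : κ → Type*}
  [∀ i, TopologicalSpace (R i)] [∀ k, TopologicalSpace (S k)]

theorem IsClosedBox.isClosed {A : Set (∀ i, R i)} (h : IsClosedBox A) : IsClosed A := by
  obtain ⟨b, hb, rfl⟩ := h
  exact isClosed_set_pi fun i _ => (hb i).1

section Update

variable [DecidableEq ι] [DecidableEq κ]

/-- A box containing `x` and `y` contains every mixture of their coordinates; with only two points
available, changing one differing coordinate of `x` must already give `y`. -/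
theorem isClosedBox_pair_iff [∀ i, T1Space (R i)] {x y : ∀ i, R i} (hxy : x ≠ y) :
    IsClosedBox {x, y} ↔ ∃ i t, y = update x i t := by
  constructor
  · rintro ⟨b, hb, hA⟩
    have hx : ∀ i, x i ∈ b i := fun i =>
      (show x ∈ univ.pi b from hA ▸ mem_insert _ _) i (mem_univ i)
    have hy : ∀ i, y i ∈ b i := fun i =>
      (show y ∈ univ.pi b from hA ▸ mem_insert_of_mem _ rfl) i (mem_univ i)
    obtain ⟨i, hi⟩ := Function.ne_iff.1 hxy
    refine ⟨i, y i, ?_⟩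
    have hz : update x i (y i) ∈ ({x, y} : Set (∀ i, R i)) := by
      rw [hA]
      intro j _
      rcases eq_or_ne j i with rfl | h
      · simpa using hy j
      · simpa [h] using hx j
    rcases hz with h | h
    · exact absurd (by simpa using (congrFun h i).symm) hi
    · exact h.symm
  · rintro ⟨i, t, rfl⟩
    refine ⟨update (fun j => {x j}) i {x i, t}, fun j => ?_, ?_⟩
    · rcases eq_or_ne j i with rfl | h
      · simp only [update_self]
        exact ⟨(finite_singleton t).insert (x j) |>.isClosed, insert_nonempty _ _⟩
      · simp only [update_of_ne h]
        exact ⟨isClosed_singleton, singleton_nonempty _⟩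
    · ext z
      simp only [mem_insert_iff, mem_singleton_iff, mem_pi, mem_univ, true_imp_iff]
      constructor
      · rintro (rfl | rfl) j
        · rcases eq_or_ne j i with rfl | h <;> simp [*]
        · rcases eq_or_ne j i with rfl | h <;> simp [*]
      · intro h
        have hi : z i = x i ∨ z i = t := by simpa using h i
        have hj : ∀ j ≠ i, z j = x j := fun j hj => by simpa [hj] using h j
        refine hi.imp (fun hi => ?_) fun hi => ?_
        · ext j
          rcases eq_or_ne j i with rfl | h
          exacts [hi, hj j h]
        · ext j
          rcases eq_or_ne j i with rfl | h
          · simpa using hi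
          · simpa [h] using hj j h

theorem isClosedBox_line [∀ i, T1Space (R i)] (x : ∀ i, R i) (i : ι) {A : Set (R i)}
    (hA : IsClosed A) (hne : A.Nonempty) :
    IsClosedBox {z | ∃ t ∈ A, z = update x i t} := by
  refine ⟨update (fun j => {x j}) i A, fun j => ?_, ?_⟩
  · rcases eq_or_ne j i with rfl | h
    · simpa only [update_self] using ⟨hA, hne⟩
    · simp only [update_of_ne h]
      exact ⟨isClosed_singleton, singleton_nonempty _⟩
  · ext z
    simp only [mem_ofPred_eq, mem_pi, mem_univ, true_imp_iff]
    constructor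
    · rintro ⟨t, ht, rfl⟩ j
      rcases eq_or_ne j i with rfl | h <;> simp [*]
    · intro h
      refine ⟨z i, by simpa using h i, ?_⟩
      ext j
      rcases eq_or_ne j i with rfl | hj
      · simp
      · simpa [hj] using h j

/-- A bijection preserving closed boxes preserves the relation of differing in at most one
coordinate. -/
theorem exists_update_of_isClosedBox_image [∀ i, T1Space (R i)] [∀ k, T1Space (S k)]
    (Φ : (∀ i, R i) ≃ (∀ k, S k)) (hΦ : ∀ A, IsClosedBox A → IsClosedBox (Φ '' A))
    {x y : ∀ i, R i} (hne : x ≠ y) (h : ∃ i t, y = update x i t) :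
    ∃ k s, Φ y = update (Φ x) k s := by
  rw [← isClosedBox_pair_iff hne] at h
  rw [← isClosedBox_pair_iff (Φ.injective.ne hne), ← image_pair]
  exact hΦ _ h

/-- A bijection preserving closed boxes maps lines into lines. -/
theorem exists_line_of_isClosedBox_image [∀ i, T1Space (R i)] [∀ k, T1Space (S k)]
    [∀ i, Nontrivial (R i)]
    (Φ : (∀ i, R i) ≃ (∀ k, S k)) (hΦ : ∀ A, IsClosedBox A → IsClosedBox (Φ '' A))
    (x : ∀ i, R i) (i : ι) :
    ∃ k, ∀ t, ∃ s, Φ (update x i t) = update (Φ x) k s := by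
  obtain ⟨t₀, ht₀⟩ := exists_ne (x i)
  have hne : ∀ t ≠ x i, x ≠ update x i t := fun t ht h => ht (by simpa using (congrFun h i).symm)
  obtain ⟨k, s₀, hk⟩ := exists_update_of_isClosedBox_image Φ hΦ (hne t₀ ht₀) ⟨i, t₀, rfl⟩
  refine ⟨k, fun t => ?_⟩
  by_cases ht : t = x i
  · exact ⟨Φ x k, by simp [ht]⟩
  by_cases htt : t = t₀
  · exact ⟨s₀, htt ▸ hk⟩
  obtain ⟨l, s, hl⟩ := exists_update_of_isClosedBox_image Φ hΦ (hne t ht) ⟨i, t, rfl⟩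
  have hne' : update x i t₀ ≠ update x i t := fun h => htt (by simpa using (congrFun h i).symm)
  obtain ⟨m, r, hm⟩ := exists_update_of_isClosedBox_image Φ hΦ hne' ⟨i, t, by simp⟩
  -- The images of three points of a line differ pairwise in one coordinate: `k`, `l`, `m`. If `l ≠
  -- k`, the last two images differ both at `k` and at `l`, so `m` would equal both.
  rcases eq_or_ne l k with rfl | hlk
  · exact ⟨s, hl⟩
  exfalso
  have h₀ : Φ (update x i t₀) k ≠ Φ x k := fun h => by
    refine hne t₀ ht₀ (Φ.injective ?_)
    have : s₀ = Φ x k := by rw [← h, hk, update_self]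
    rw [hk, this, update_eq_self]
  have h₁ : Φ (update x i t) l ≠ Φ x l := fun h => by
    refine hne t ht (Φ.injective ?_)
    have : s = Φ x l := by rw [← h, hl, update_self]
    rw [hl, this, update_eq_self]
  have hml : m = l := by
    by_contra h
    refine h₁ ?_
    rw [hm, update_of_ne (Ne.symm h), hk, update_of_ne hlk]
  have hmk : m = k := by
    by_contra h
    refine h₀ ?_
    have := congrFun hm k
    rwa [update_of_ne (Ne.symm h), hl, update_of_ne hlk.symm, eq_comm] at this
  exact hlk (hml.symm.trans hmk)

/-- A closed set of the target factor spans a closed box in a line; its image under `Φ.symm` is a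
closed box, hence closed, and pulls back to the required preimage. -/
theorem continuous_line_of_isClosedBox_preimage [∀ k, T1Space (S k)]
    (Φ : (∀ i, R i) ≃ (∀ k, S k)) (hΦ : ∀ A, IsClosedBox A → IsClosedBox (Φ.symm '' A))
    (x : ∀ i, R i) (i : ι) (k : κ)
    (hik : ∀ t, ∃ s, Φ (update x i t) = update (Φ x) k s) :
    Continuous fun t => Φ (update x i t) k := by
  rw [continuous_iff_isClosed]
  intro A hA
  rcases A.eq_empty_or_nonempty with rfl | hne
  · simp
  have := (hΦ _ (isClosedBox_line (Φ x) k hA hne)).isClosed.preimage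
    (continuous_const.update i continuous_id : Continuous fun t => update x i t)
  convert! this using 1
  ext t
  obtain ⟨s, hs⟩ := hik t
  simp only [mem_preimage, mem_image, mem_ofPred_eq]
  constructor
  · intro h
    refine ⟨_, ⟨s, ?_, rfl⟩, ?_⟩
    · simpa [hs] using h
    · rw [← hs, Φ.symm_apply_apply]
  · rintro ⟨z, ⟨r, hr, rfl⟩, hz⟩
    rw [Equiv.symm_apply_eq] at hz
    have : Φ (update x i t) = update (Φ x) k r := hz.symm
    simpa [this] using hr

end Update

/-- A bijection of products which preserves closed boxes in both directions comes from a bijection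
of the index sets and homeomorphisms of the factors. -/
theorem exists_equiv_homeomorph_of_isClosedBox [∀ i, T1Space (R i)] [∀ k, T1Space (S k)]
    [∀ i, Nontrivial (R i)] [∀ k, Nontrivial (S k)]
    (Φ : (∀ i, R i) ≃ (∀ k, S k)) (hΦ : ∀ A, IsClosedBox A → IsClosedBox (Φ '' A))
    (hΦ' : ∀ A, IsClosedBox A → IsClosedBox (Φ.symm '' A)) :
    ∃ ψ : ι ≃ κ, ∀ i, Nonempty (R i ≃ₜ S (ψ i)) := by
  classical
  obtain ⟨x⟩ : Nonempty (∀ i, R i) := inferInstance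
  obtain ⟨y, hy⟩ : ∃ y, y = Φ x := ⟨_, rfl⟩
  have hx : x = Φ.symm y := by simp [hy]
  choose ψ hψ using exists_line_of_isClosedBox_image Φ hΦ x
  choose θ hθ using exists_line_of_isClosedBox_image Φ.symm hΦ' y
  rw [← hy] at hψ
  rw [← hx] at hθ
  -- A second point on the line, available by nontriviality, makes its direction unique, so going
  -- there and back returns the same index.
  have hθψ : ∀ i, θ (ψ i) = i := fun i => by
    obtain ⟨t, ht⟩ := exists_ne (x i)
    obtain ⟨s, hs⟩ := hψ i t
    obtain ⟨t', ht'⟩ := hθ (ψ i) s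
    rw [← hs, Φ.symm_apply_apply] at ht'
    by_contra h
    refine ht ?_
    have := congrFun ht' i
    rwa [update_self, update_of_ne (Ne.symm h)] at this
  have hψθ : ∀ k, ψ (θ k) = k := fun k => by
    obtain ⟨s, hs⟩ := exists_ne (y k)
    obtain ⟨t, ht⟩ := hθ k s
    obtain ⟨s', hs'⟩ := hψ (θ k) t
    rw [← ht, Φ.apply_symm_apply] at hs'
    by_contra h
    refine hs ?_
    have := congrFun hs' k
    rwa [update_self, update_of_ne (Ne.symm h)] at this
  refine ⟨⟨ψ, θ, hθψ, hψθ⟩, fun i => ⟨?_⟩⟩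
  have hθi : ∀ s, ∃ t, Φ.symm (update y (ψ i) s) = update x i t := by
    have := hθ (ψ i)
    rwa [hθψ i] at this
  refine
    { toFun := fun t => Φ (update x i t) (ψ i)
      invFun := fun s => Φ.symm (update y (ψ i) s) i
      left_inv := fun t => ?_
      right_inv := fun s => ?_
      continuous_toFun := ?_
      continuous_invFun := ?_ }
  · obtain ⟨s, hs⟩ := hψ i t
    have : update y (ψ i) (Φ (update x i t) (ψ i)) = Φ (update x i t) := by rw [hs]; simp
    simp only [this, Φ.symm_apply_apply, update_self]
  · obtain ⟨t, ht⟩ := hθi s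
    have : update x i (Φ.symm (update y (ψ i) s) i) = Φ.symm (update y (ψ i) s) := by
      rw [ht]; simp
    change Φ (update x i (Φ.symm (update y (ψ i) s) i)) (ψ i) = s
    rw [this, Φ.apply_symm_apply, update_self]
  · exact continuous_line_of_isClosedBox_preimage Φ hΦ' x i (ψ i) (hy ▸ hψ i)
  · exact continuous_line_of_isClosedBox_preimage Φ.symm (by simpa using hΦ) y (ψ i) i (hx ▸ hθi)

end ClosedBoxes

/-! ### Recovering the product from the order -/

section BoxCoordinates

/-- `M` identifies the product of the spaces `R i` with the set of maximal elements of `P`, in such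
a way that the sets of maximal elements above a given element are exactly the closed boxes. -/
structure IsBoxCoordinates {ι : Type*} {R : ι → Type*} [∀ i, TopologicalSpace (R i)]
    {P : Type*} [PartialOrder P] (M : (∀ i, R i) → P) : Prop where
  injective : Injective M
  isMax_iff : ∀ p, IsMax p ↔ p ∈ range M
  isClosedBox_iff : ∀ A : Set (∀ i, R i), IsClosedBox A ↔ ∃ p, A = {x | p ≤ M x}

variable {ι κ : Type*} {R : ι → Type*} {S : κ → Type*}
  [∀ i, TopologicalSpace (R i)] [∀ k, TopologicalSpace (S k)]
  {P Q : Type*} [PartialOrder P] [PartialOrder Q]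

theorem IsBoxCoordinates.exists_of_orderIso {M : (∀ i, R i) → P} {N : (∀ k, S k) → Q}
    (hM : IsBoxCoordinates M) (hN : IsBoxCoordinates N) (φ : P ≃o Q) :
    ∃ f : (∀ i, R i) → (∀ k, S k), ∀ x, N (f x) = φ (M x) := by
  have : ∀ x, ∃ y, N y = φ (M x) := fun x =>
    (hN.isMax_iff _).1 ((φ.isMax_apply).2 ((hM.isMax_iff _).2 ⟨x, rfl⟩))
  exact ⟨fun x => (this x).choose, fun x => (this x).choose_spec⟩

theorem IsBoxCoordinates.isClosedBox_image {M : (∀ i, R i) → P} {N : (∀ k, S k) → Q}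
    (hM : IsBoxCoordinates M) (hN : IsBoxCoordinates N) (φ : P ≃o Q)
    (Φ : (∀ i, R i) ≃ (∀ k, S k)) (h : ∀ x, N (Φ x) = φ (M x)) {A : Set (∀ i, R i)}
    (hA : IsClosedBox A) : IsClosedBox (Φ '' A) := by
  obtain ⟨p, rfl⟩ := (hM.isClosedBox_iff A).1 hA
  refine (hN.isClosedBox_iff _).2 ⟨φ p, ?_⟩
  ext y
  obtain ⟨x, rfl⟩ := Φ.surjective y
  simp [h]

theorem IsBoxCoordinates.exists_equiv_homeomorph
    [∀ i, T1Space (R i)] [∀ k, T1Space (S k)] [∀ i, Nontrivial (R i)] [∀ k, Nontrivial (S k)]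
    {M : (∀ i, R i) → P} {N : (∀ k, S k) → Q}
    (hM : IsBoxCoordinates M) (hN : IsBoxCoordinates N) (φ : P ≃o Q) :
    ∃ ψ : ι ≃ κ, ∀ i, Nonempty (R i ≃ₜ S (ψ i)) := by
  obtain ⟨f, hf⟩ := hM.exists_of_orderIso hN φ
  obtain ⟨g, hg⟩ := hN.exists_of_orderIso hM φ.symm
  let Φ : (∀ i, R i) ≃ (∀ k, S k) :=
    ⟨f, g, fun x => hM.injective (by simp [hf, hg]), fun y => hN.injective (by simp [hf, hg])⟩
  exact exists_equiv_homeomorph_of_isClosedBox Φ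
    (fun A hA => hM.isClosedBox_image hN φ Φ hf hA)
    (fun A hA => hN.isClosedBox_image hM φ.symm Φ.symm hg hA)

end BoxCoordinates

/-! ### Separation axioms when one point is added -/

section Separation

open Filter

variable {X Z : Type*} [TopologicalSpace X] [TopologicalSpace Z]

/-- Adding a point to a regular space whose complement is normal gives a normal space. -/
theorem Topology.IsOpenEmbedding.normalSpace_of_compl_range [RegularSpace Z] [NormalSpace X]
    {e : X → Z} (he : IsOpenEmbedding e) {p : Z} (hp : (range e)ᶜ = {p}) : NormalSpace Z := by
  have key : ∀ s t : Set Z, IsClosed s → IsClosed t → Disjoint s t → p ∉ t →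
      SeparatedNhds s t := by
    intro s t hs ht hst hpt
    have htr : t ⊆ range e := fun z hz => by
      by_contra h
      have : z ∈ ({p} : Set Z) := hp ▸ h
      exact hpt (this ▸ hz)
    obtain ⟨U, W, hU, hW, hsU, htW, hUW⟩ := normal_separation (hs.preimage he.continuous)
      (ht.preimage he.continuous) (hst.preimage e)
    obtain ⟨V, hV, hVo, hVt⟩ : ∃ V, p ∈ V ∧ IsOpen V ∧ closure V ⊆ tᶜ := by
      obtain ⟨K, ⟨hK, hKc⟩, hKt⟩ :=
        (closed_nhds_basis p).mem_iff.1 (ht.isOpen_compl.mem_nhds hpt)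
      exact ⟨interior K, mem_interior_iff_mem_nhds.2 hK, isOpen_interior,
        (closure_minimal interior_subset hKc).trans hKt⟩
    -- Adding `V` covers `p` in case it lies in `s`; removing `closure V` keeps the two sets
    -- disjoint and costs no point of `t`.
    refine ⟨e '' U ∪ V, e '' W \ closure V, (he.isOpenMap _ hU).union hVo,
      (he.isOpenMap _ hW).sdiff isClosed_closure, ?_, ?_, ?_⟩
    · intro z hz
      by_cases h : z ∈ range e
      · obtain ⟨x, rfl⟩ := h
        exact Or.inl ⟨x, hsU hz, rfl⟩
      · have : z ∈ ({p} : Set Z) := hp ▸ h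
        exact Or.inr (this ▸ hV)
    · intro z hz
      obtain ⟨x, rfl⟩ := htr hz
      exact ⟨⟨x, htW hz, rfl⟩, fun h => hVt h hz⟩
    · rw [disjoint_union_left]
      exact ⟨((disjoint_image_iff he.injective).2 hUW).mono_right sdiff_subset,
        disjoint_sdiff_right.mono_left subset_closure⟩
  refine ⟨fun s t hs ht hst => ?_⟩
  by_cases hpt : p ∈ t
  · exact (key t s ht hs hst.symm fun hps => disjoint_left.1 hst hps hpt).symm
  · exact key s t hs ht hst hpt

/-- Adding a point to a regular space whose complement is completely normal gives a completely
normal space. -/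
theorem Topology.IsOpenEmbedding.completelyNormalSpace_of_compl_range [RegularSpace Z]
    [CompletelyNormalSpace X] {e : X → Z} (he : IsOpenEmbedding e) {p : Z}
    (hp : (range e)ᶜ = {p}) : CompletelyNormalSpace Z := by
  have sep : ∀ s t : Set Z, Disjoint (closure s) t → Disjoint s (closure t) →
      ∃ U W : Set X, IsOpen U ∧ IsOpen W ∧ e ⁻¹' s ⊆ U ∧ e ⁻¹' t ⊆ W ∧ Disjoint U W := by
    intro s t h₁ h₂
    have := completely_normal (s := e ⁻¹' s) (t := e ⁻¹' t)
      ((h₁.preimage e).mono_left (he.continuous.closure_preimage_subset s))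
      ((h₂.preimage e).mono_right (he.continuous.closure_preimage_subset t))
    rw [← separatedNhds_iff_disjoint] at this
    exact this
  have hr : ∀ s : Set Z, p ∉ s → s ⊆ range e := fun s hs z hz => by
    by_contra h
    have : z ∈ ({p} : Set Z) := hp ▸ h
    exact hs (this ▸ hz)
  have key : ∀ s t : Set Z, Disjoint (closure s) t → Disjoint s (closure t) → p ∉ t →
      SeparatedNhds s t := by
    intro s t h₁ h₂ hpt
    obtain ⟨U, W, hU, hW, hsU, htW, hUW⟩ := sep s t h₁ h₂
    -- Here `t` need not be closed, so `p ∉ t` does not keep `p` out of `closure t`. If `p ∈ s`, the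
    -- hypothesis does; otherwise both sets lie in the range of `e` and are separated there.
    by_cases hps : p ∈ s
    · have hpt' : p ∉ closure t := disjoint_left.1 h₂ hps
      obtain ⟨V, hV, hVo, hVt⟩ : ∃ V, p ∈ V ∧ IsOpen V ∧ closure V ⊆ tᶜ := by
        obtain ⟨K, ⟨hK, hKc⟩, hKt⟩ :=
          (closed_nhds_basis p).mem_iff.1 (isClosed_closure.isOpen_compl.mem_nhds hpt')
        exact ⟨interior K, mem_interior_iff_mem_nhds.2 hK, isOpen_interior,
          ((closure_minimal interior_subset hKc).trans hKt).trans
            (compl_subset_compl.2 subset_closure)⟩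
      refine ⟨e '' U ∪ V, e '' W \ closure V, (he.isOpenMap _ hU).union hVo,
        (he.isOpenMap _ hW).sdiff isClosed_closure, ?_, ?_, ?_⟩
      · intro z hz
        by_cases h : z ∈ range e
        · obtain ⟨x, rfl⟩ := h
          exact Or.inl ⟨x, hsU hz, rfl⟩
        · have : z ∈ ({p} : Set Z) := hp ▸ h
          exact Or.inr (this ▸ hV)
      · intro z hz
        obtain ⟨x, rfl⟩ := hr t hpt hz
        exact ⟨⟨x, htW hz, rfl⟩, fun h => hVt h hz⟩
      · rw [disjoint_union_left]
        exact ⟨((disjoint_image_iff he.injective).2 hUW).mono_right sdiff_subset,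
          disjoint_sdiff_right.mono_left subset_closure⟩
    · refine ⟨e '' U, e '' W, he.isOpenMap _ hU, he.isOpenMap _ hW, ?_, ?_,
        (disjoint_image_iff he.injective).2 hUW⟩
      · intro z hz
        obtain ⟨x, rfl⟩ := hr s hps hz
        exact ⟨x, hsU hz, rfl⟩
      · intro z hz
        obtain ⟨x, rfl⟩ := hr t hpt hz
        exact ⟨x, htW hz, rfl⟩
  refine ⟨fun s t h₁ h₂ => ?_⟩
  rw [← separatedNhds_iff_disjoint]
  by_cases hpt : p ∈ t
  · exact (key t s h₂.symm h₁.symm fun hps => disjoint_left.1 h₁ (subset_closure hps) hpt).symm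
  · exact key s t h₁ h₂ hpt

theorem SepIndex.IsT.of_isOpenEmbedding {i : SepIndex} [T35Space Z] (hX : i.IsT X)
    {e : X → Z} (he : IsOpenEmbedding e) {p : Z} (hp : (range e)ᶜ = {p}) : i.IsT Z := by
  cases i
  · exact (inferInstance : T35Space Z)
  · have : T4Space X := hX
    have := he.normalSpace_of_compl_range hp
    exact (inferInstanceAs (T4Space Z))
  · have : T5Space X := hX
    have := he.completelyNormalSpace_of_compl_range hp
    exact { }

theorem SepIndex.IsT.t35Space {i : SepIndex} (hX : i.IsT X) : T35Space X := by
  cases i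
  · exact hX
  · have : T4Space X := hX
    infer_instance
  · have : T5Space X := hX
    infer_instance

/-- The image of a compact neighbourhood of `x` is already closed, and by density its closure is a
neighbourhood of the image of `x`. -/
theorem isOpen_range_stoneCechUnit [T35Space X] [LocallyCompactSpace X] :
    IsOpen (range (stoneCechUnit : X → StoneCech X)) := by
  rw [isOpen_iff_mem_nhds]
  rintro _ ⟨x, rfl⟩
  obtain ⟨K, hK, hKx⟩ := exists_compact_mem_nhds x
  have := isDenseInducing_stoneCechUnit.closure_image_mem_nhds hKx
  rw [(hK.image continuous_stoneCechUnit).isClosed.closure_eq] at this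
  exact Filter.mem_of_superset this (image_subset_range _ _)

end Separation

/-! ### The one-point extension with prescribed traces -/

section BoxTopology

variable {X : Type u} [TopologicalSpace X]

/-- The component of a point. -/
def Component.of (x : X) : Component X := ⟨connectedComponent x, x, rfl⟩

theorem Component.mem_of (x : X) : x ∈ (Component.of x).1 := mem_connectedComponent

theorem Component.eq_of_mem {C : Component X} {x : X} (h : x ∈ C.1) : Component.of x = C := by
  obtain ⟨_, y, rfl⟩ := C
  exact Subtype.ext (connectedComponent_eq h).symm

theorem Component.isClosed (C : Component X) : IsClosed C.1 := by
  obtain ⟨_, y, rfl⟩ := C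
  exact isClosed_connectedComponent

theorem Component.isOpen [LocallyConnectedSpace X] (C : Component X) : IsOpen C.1 := by
  obtain ⟨_, y, rfl⟩ := C
  exact isOpen_connectedComponent

theorem Component.isPreconnected (C : Component X) : IsPreconnected C.1 := by
  obtain ⟨_, y, rfl⟩ := C
  exact isPreconnected_connectedComponent

instance [LocallyConnectedSpace X] [LocallyCompactSpace X] (C : Component X) :
    LocallyCompactSpace C.1 :=
  C.isOpen.locallyCompactSpace

/-- A set `V` contains a deleted neighbourhood of `none` if in every component `C` it contains the
trace of a neighbourhood of the subset `b C` of the Stone–Čech remainder of `C`. -/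
def IsBoxNhd (b : ∀ C : Component X, Set (StoneCechRemainder C.1)) (V : Set X) : Prop :=
  ∀ C : Component X, ∃ W : Set (StoneCech C.1), IsOpen W ∧ (∀ q ∈ b C, q.1 ∈ W) ∧
    ∀ c : C.1, stoneCechUnit c ∈ W → c.1 ∈ V

/-- The one-point extension of `X` in which the neighbourhoods of the additional point are given by
independent choices of neighbourhoods of `b C` for all components `C`. -/
def BoxExtension (_ : ∀ C : Component X, Set (StoneCechRemainder C.1)) : Type u := Option X

namespace BoxExtension

variable (b : ∀ C : Component X, Set (StoneCechRemainder C.1))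

/-- The inclusion of `X`. -/
def incl (x : X) : BoxExtension b := Option.some x

/-- The additional point. -/
def pt : BoxExtension b := Option.none

variable {b}

theorem eq_pt_or (z : BoxExtension b) : z = pt b ∨ ∃ x, z = incl b x := by
  cases z
  exacts [Or.inl rfl, Or.inr ⟨_, rfl⟩]

theorem incl_injective : Injective (incl b) := Option.some_injective X

theorem incl_ne_pt (x : X) : incl b x ≠ pt b := Option.some_ne_none x

theorem compl_range_incl : (range (incl b))ᶜ = {pt b} := by
  ext z
  rcases eq_pt_or z with rfl | ⟨x, rfl⟩
  · simp [incl_ne_pt]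
  · simp [incl_ne_pt]

instance : TopologicalSpace (BoxExtension b) where
  IsOpen V := IsOpen (incl b ⁻¹' V) ∧ (pt b ∈ V → IsBoxNhd b (incl b ⁻¹' V))
  isOpen_univ := ⟨isOpen_univ, fun _ C => ⟨univ, isOpen_univ, fun _ _ => trivial, fun _ _ => trivial⟩⟩
  isOpen_inter V V' h h' := by
    refine ⟨h.1.inter h'.1, fun hp C => ?_⟩
    obtain ⟨W, hW, hb, hV⟩ := h.2 hp.1 C
    obtain ⟨W', hW', hb', hV'⟩ := h'.2 hp.2 C
    exact ⟨W ∩ W', hW.inter hW', fun q hq => ⟨hb q hq, hb' q hq⟩,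
      fun c hc => ⟨hV c hc.1, hV' c hc.2⟩⟩
  isOpen_sUnion 𝒱 h := by
    refine ⟨?_, ?_⟩
    · rw [preimage_sUnion]
      exact isOpen_biUnion fun V hV => (h V hV).1
    · rintro ⟨V, hV, hp⟩ C
      obtain ⟨W, hW, hb, hWV⟩ := (h V hV).2 hp C
      exact ⟨W, hW, hb, fun c hc => ⟨V, hV, hWV c hc⟩⟩

theorem isOpen_iff {V : Set (BoxExtension b)} :
    IsOpen V ↔ IsOpen (incl b ⁻¹' V) ∧ (pt b ∈ V → IsBoxNhd b (incl b ⁻¹' V)) := Iff.rfl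

theorem isOpenEmbedding_incl : IsOpenEmbedding (incl b) := by
  refine .of_continuous_injective_isOpenMap ⟨fun V hV => hV.1⟩ incl_injective fun U hU => ?_
  refine isOpen_iff.2 ⟨by rwa [preimage_image_eq _ incl_injective], ?_⟩
  rintro ⟨x, -, hx⟩
  exact absurd hx (incl_ne_pt x)

theorem isOpen_insert_pt {V : Set X} (hV : IsOpen V) (h : IsBoxNhd b V) :
    IsOpen (insert (pt b) (incl b '' V)) := by
  have : incl b ⁻¹' insert (pt b) (incl b '' V) = V := by
    ext x
    simp [incl_ne_pt, incl_injective.eq_iff]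
  exact isOpen_iff.2 ⟨this.symm ▸ hV, fun _ => this.symm ▸ h⟩

theorem pt_mem_closure (C : Component X) (hb : (b C).Nonempty) :
    pt b ∈ closure (incl b '' C.1) := by
  rw [mem_closure_iff]
  intro V hV hp
  obtain ⟨W, hW, hbW, hWV⟩ := hV.2 hp C
  obtain ⟨q, hq⟩ := hb
  obtain ⟨c, hc⟩ := denseRange_stoneCechUnit.exists_mem_open hW ⟨q.1, hbW q hq⟩
  exact ⟨incl b c, hWV c hc, c, c.2, rfl⟩

theorem denseRange_incl [Nonempty X] (hb : ∀ C, (b C).Nonempty) : DenseRange (incl b) := by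
  intro z
  rcases eq_pt_or z with rfl | ⟨x, rfl⟩
  · exact closure_mono (image_subset_range _ _)
      (pt_mem_closure (Component.of (Classical.arbitrary X)) (hb _))
  · exact subset_closure (mem_range_self x)

/-- The closures of the components are connected and all contain the added point. -/
theorem connectedSpace (hb : ∀ C, (b C).Nonempty) : ConnectedSpace (BoxExtension b) := by
  have : PreconnectedSpace (BoxExtension b) := by
    refine ⟨isPreconnected_of_forall (pt b) fun z _ => ?_⟩
    rcases eq_pt_or z with rfl | ⟨x, rfl⟩
    · exact ⟨{pt b}, subset_univ _, rfl, rfl, isPreconnected_singleton⟩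
    · exact ⟨closure (incl b '' (Component.of x).1), subset_univ _, pt_mem_closure _ (hb _),
        subset_closure ⟨x, Component.mem_of x, rfl⟩,
        ((Component.of x).isPreconnected.image _
          isOpenEmbedding_incl.continuous.continuousOn).closure⟩
  exact { toNonempty := ⟨pt b⟩ }

/-- Functions on the Stone–Čech compactifications of the components which have the same constant
value on all the sets `b C` can be glued. -/
theorem exists_continuous_glue [LocallyConnectedSpace X] {E : Type*} [TopologicalSpace E] (r : E)
    (g : ∀ C : Component X, StoneCech C.1 → E) (hg : ∀ C, Continuous (g C))
    (hr : ∀ C, ∀ q ∈ b C, g C q.1 = r) :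
    ∃ f : BoxExtension b → E, Continuous f ∧ f (pt b) = r ∧
      ∀ (C : Component X) (c : C.1), f (incl b c) = g C (stoneCechUnit c) := by
  let f : BoxExtension b → E := fun z => Option.elim z r
    fun x => g (Component.of x) (stoneCechUnit ⟨x, Component.mem_of x⟩)
  have hf : ∀ (C : Component X) (c : C.1), f (incl b c) = g C (stoneCechUnit c) := by
    rintro C ⟨x, hx⟩
    obtain rfl := Component.eq_of_mem hx
    rfl
  refine ⟨f, ⟨fun V hV => isOpen_iff.2 ⟨?_, fun hp C => ?_⟩⟩, rfl, hf⟩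
  · rw [← preimage_comp]
    refine IsOpen.preimage ?_ hV
    rw [continuous_iff_continuousAt]
    intro x
    have hC := (Component.of x).isOpen
    refine ContinuousOn.continuousAt ?_ (hC.mem_nhds (Component.mem_of x))
    rw [continuousOn_iff_continuous_domRestrict]
    exact ((hg (Component.of x)).comp continuous_stoneCechUnit).congr fun c => (hf _ c).symm
  · refine ⟨g C ⁻¹' V, hV.preimage (hg C), fun q hq => ?_, fun c hc => ?_⟩
    · rw [mem_preimage, hr C q hq]
      exact hp
    · rw [mem_preimage, mem_preimage, hf]
      exact hc

variable [LocallyConnectedSpace X] [LocallyCompactSpace X] [T35Space X]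

theorem isClosed_image_val (C : Component X) {s : Set (StoneCechRemainder C.1)} (hs : IsClosed s) :
    IsClosed (Subtype.val '' s) :=
  (isOpen_range_stoneCechUnit.isClosed_compl).isClosedEmbedding_subtypeVal.isClosedMap s hs

theorem exists_unitInterval {T : Type*} [TopologicalSpace T] [NormalSpace T] {s t : Set T}
    (hs : IsClosed s) (ht : IsClosed t) (h : Disjoint s t) :
    ∃ g : T → unitInterval, Continuous g ∧ (∀ x ∈ s, g x = 0) ∧ ∀ x ∈ t, g x = 1 := by
  obtain ⟨f, h0, h1, hI⟩ := exists_continuous_zero_one_of_isClosed hs ht h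
  exact ⟨fun x => ⟨f x, hI x⟩, by fun_prop, fun x hx => Subtype.ext (h0 hx),
    fun x hx => Subtype.ext (h1 hx)⟩

/-- Urysohn functions are chosen on each compact `βC` separately, constant on `b C` with a common
value, and glued. -/
theorem t35Space (hb : ∀ C, IsClosed (b C)) : T35Space (BoxExtension b) := by
  have hK := fun C => isClosed_image_val C (hb C)
  have : T1Space (BoxExtension b) := by
    refine ⟨fun z => ?_⟩
    rcases eq_pt_or z with rfl | ⟨x, rfl⟩
    · rw [← compl_range_incl]
      exact isOpenEmbedding_incl.isOpen_range.isClosed_compl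
    · rw [← isOpen_compl_iff]
      have : incl b ⁻¹' {incl b x}ᶜ = {x}ᶜ := by
        ext y
        simp [incl_injective.eq_iff]
      refine isOpen_iff.2 ⟨this ▸ isOpen_compl_singleton, fun _ C => ?_⟩
      rw [this]
      refine ⟨(stoneCechUnit '' {c : C.1 | c.1 = x})ᶜ, ?_, ?_, ?_⟩
      · refine (Set.Subsingleton.isClosed (Set.Subsingleton.image ?_ _)).isOpen_compl
        exact fun c hc d hd => Subtype.ext (Eq.trans hc (Eq.symm hd))
      · rintro q - ⟨c, -, hc⟩
        exact q.2 ⟨c, hc⟩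
      · exact fun c hc hx => hc ⟨c, hx, rfl⟩
  have : CompletelyRegularSpace (BoxExtension b) := by
    refine ⟨fun z A hA hz => ?_⟩
    rcases eq_pt_or z with rfl | ⟨x, rfl⟩
    · have hN := (isOpen_iff.1 hA.isOpen_compl).2 hz
      choose W hW hbW hWA using hN
      have hg := fun C => exists_unitInterval (hK C) (hW C).isClosed_compl (by
        rw [disjoint_compl_right_iff_subset]
        rintro _ ⟨q, hq, rfl⟩
        exact hbW C q hq)
      choose g hg hg0 hg1 using hg
      obtain ⟨f, hf, hfp, hfg⟩ := exists_continuous_glue (b := b) 0 g hg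
        fun C q hq => hg0 C _ ⟨q, hq, rfl⟩
      refine ⟨f, hf, hfp, fun z hzA => ?_⟩
      rcases eq_pt_or z with rfl | ⟨y, rfl⟩
      · exact absurd hzA hz
      · rw [hfg (Component.of y) ⟨y, Component.mem_of y⟩]
        exact hg1 _ _ fun h => hWA _ _ h hzA
    · have : ∀ C : Component X, ∃ g : StoneCech C.1 → unitInterval, Continuous g ∧
          (∀ q ∈ b C, g q.1 = 1) ∧ (∀ c : C.1, incl b c ∈ A → g (stoneCechUnit c) = 1) ∧
          ∀ h : x ∈ C.1, g (stoneCechUnit ⟨x, h⟩) = 0 := by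
        intro C
        by_cases hx : x ∈ C.1
        · have hA' : IsClosed {c : C.1 | incl b c ∈ A} :=
            hA.preimage (isOpenEmbedding_incl.continuous.comp continuous_subtype_val)
          obtain ⟨g, hg, hg0, hg1⟩ := exists_unitInterval
            (isClosed_singleton (x := (stoneCechUnit ⟨x, hx⟩ : StoneCech C.1)))
            ((hK C).union (isClosed_closure (s := stoneCechUnit '' {c : C.1 | incl b c ∈ A}))) (by
              rw [disjoint_singleton_left]
              rintro (⟨q, -, hq⟩ | h)
              · exact q.2 ⟨_, hq.symm⟩
              · rw [← mem_preimage, ← isInducing_stoneCechUnit.closure_eq_preimage_closure_image,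
                  hA'.closure_eq] at h
                exact hz h)
          exact ⟨g, hg, fun q hq => hg1 _ (Or.inl ⟨q, hq, rfl⟩),
            fun c hc => hg1 _ (Or.inr (subset_closure ⟨c, hc, rfl⟩)), fun _ => hg0 _ rfl⟩
        · exact ⟨fun _ => 1, continuous_const, fun _ _ => rfl, fun _ _ => rfl,
            fun h => absurd h hx⟩
      choose g hg hgb hgA hgx using this
      obtain ⟨f, hf, hfp, hfg⟩ := exists_continuous_glue (b := b) 1 g hg hgb
      refine ⟨f, hf, ?_, fun z hzA => ?_⟩
      · rw [hfg (Component.of x) ⟨x, Component.mem_of x⟩]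
        exact hgx _ _
      · rcases eq_pt_or z with rfl | ⟨y, rfl⟩
        · exact hfp
        · rw [hfg (Component.of y) ⟨y, Component.mem_of y⟩]
          exact hgA _ _ hzA
  exact { }

end BoxExtension

end BoxTopology

/-! ### Traces of connectifications and the universal property of boxes -/

namespace OnePointConnectification

open Filter

variable {i : SepIndex} {X : Type u} [TopologicalSpace X]

/-- The additional point of a one-point connectification. -/
noncomputable def pt (Z : OnePointConnectification i X) : Z.carrier := Z.compl_range_incl.choose

theorem compl_range_incl_eq (Z : OnePointConnectification i X) : (range Z.incl)ᶜ = {Z.pt} :=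
  Z.compl_range_incl.choose_spec

theorem incl_ne_pt (Z : OnePointConnectification i X) (x : X) : Z.incl x ≠ Z.pt := fun h => by
  have : Z.pt ∈ (range Z.incl)ᶜ := Z.compl_range_incl_eq ▸ rfl
  exact this ⟨x, h⟩

theorem eq_pt_or (Z : OnePointConnectification i X) (z : Z.carrier) :
    z = Z.pt ∨ ∃ x, z = Z.incl x := by
  by_cases h : z ∈ range Z.incl
  · exact Or.inr (h.imp fun _ => Eq.symm)
  · have : z ∈ ({Z.pt} : Set Z.carrier) := Z.compl_range_incl_eq ▸ h
    exact Or.inl this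

theorem isOpenEmbedding_incl (Z : OnePointConnectification i X) : IsOpenEmbedding Z.incl := by
  have : T2Space Z.carrier := Z.isT.t2Space
  refine ⟨Z.isEmbedding_incl, ?_⟩
  rw [← isClosed_compl_iff, Z.compl_range_incl_eq]
  exact isClosed_singleton

/-- The trace on a component `C` of the neighbourhoods of the additional point. -/
noncomputable def traceFilter (Z : OnePointConnectification i X) (C : Component X) : Filter C.1 :=
  comap (fun c : C.1 => Z.incl c) (𝓝 Z.pt)

/-- The set of points of the Stone–Čech remainder of `C` which are mapped to the additional point
by the extension of the inclusion of `C`. -/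
def trace (Z : OnePointConnectification i X) (C : Component X) : Set (StoneCechRemainder C.1) :=
  {q | ClusterPt q.1 (map stoneCechUnit (Z.traceFilter C))}

theorem isClosed_trace (Z : OnePointConnectification i X) (C : Component X) :
    IsClosed (Z.trace C) :=
  isClosed_setOfPred_clusterPt.preimage continuous_subtype_val

/-- Otherwise the image of `C` would be a nonempty clopen set missing the added point. -/
theorem traceFilter_neBot [LocallyConnectedSpace X] (Z : OnePointConnectification i X)
    (C : Component X) : (Z.traceFilter C).NeBot := by
  have hC : (Z.incl '' C.1).Nonempty := by
    obtain ⟨_, x, rfl⟩ := C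
    exact ⟨_, x, mem_connectedComponent, rfl⟩
  have hp : Z.pt ∈ closure (Z.incl '' C.1) := by
    by_contra h
    have hcl : IsClosed (Z.incl '' C.1) := by
      refine isClosed_of_closure_subset fun z hz => ?_
      rcases Z.eq_pt_or z with rfl | ⟨x, rfl⟩
      · exact absurd hz h
      · refine ⟨x, ?_, rfl⟩
        rw [← mem_preimage, ← Z.isEmbedding_incl.isInducing.closure_eq_preimage_closure_image,
          C.isClosed.closure_eq] at hz
        exact hz
    have := Z.connectedSpace
    have huniv := IsClopen.eq_univ ⟨hcl, Z.isOpenEmbedding_incl.isOpenMap _ C.isOpen⟩ hC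
    obtain ⟨x, -, hx⟩ : Z.pt ∈ Z.incl '' C.1 := huniv ▸ mem_univ _
    exact Z.incl_ne_pt x hx
  rw [traceFilter, comap_neBot_iff]
  intro t ht
  obtain ⟨_, hzt, x, hx, rfl⟩ := mem_closure_iff_nhds.1 hp t ht
  exact ⟨⟨x, hx⟩, hzt⟩

/-- Compactness of `βC` gives a cluster point. It cannot lie in `C`, since the filter converges in
the Hausdorff space `Z` to the added point. -/
theorem trace_nonempty [LocallyConnectedSpace X] [T35Space X] (Z : OnePointConnectification i X)
    (C : Component X) : (Z.trace C).Nonempty := by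
  have := Z.traceFilter_neBot C
  obtain ⟨q, hq⟩ := exists_clusterPt_of_compactSpace (map stoneCechUnit (Z.traceFilter C))
  refine ⟨⟨q, ?_⟩, hq⟩
  rintro ⟨c, rfl⟩
  have : T2Space Z.carrier := Z.isT.t2Space
  have hc : ClusterPt c (Z.traceFilter C) :=
    isInducing_stoneCechUnit.mapClusterPt_iff.1 hq
  have hj : Continuous fun c : C.1 => Z.incl c :=
    Z.isEmbedding_incl.continuous.comp continuous_subtype_val
  have := hc.map hj.continuousAt (tendsto_comap : Tendsto _ (Z.traceFilter C) (𝓝 Z.pt))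
  exact Z.incl_ne_pt c (eq_of_nhds_neBot this)

/-- If the added point went to `x`, points of `X` near it would map near `x`; but these are fixed,
and `Z` is Hausdorff. -/
theorem Below.map_pt {Y Z : OnePointConnectification i X} {f : Z.carrier → Y.carrier}
    (hf : Continuous f) (h : ∀ x, f (Z.incl x) = Y.incl x) : f Z.pt = Y.pt := by
  have : T2Space Z.carrier := Z.isT.t2Space
  rcases Y.eq_pt_or (f Z.pt) with hp | ⟨x, hx⟩
  · exact hp
  exfalso
  obtain ⟨U, V, hU, hV, hpU, hxV, hUV⟩ := t2_separation (Z.incl_ne_pt x).symm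
  have hO : IsOpen (U ∩ f ⁻¹' (Y.incl '' (Z.incl ⁻¹' V))) :=
    hU.inter ((Y.isOpenEmbedding_incl.isOpenMap _
      (hV.preimage Z.isEmbedding_incl.continuous)).preimage hf)
  obtain ⟨y, hyU, w, hwV, hw⟩ := Z.denseRange_incl.exists_mem_open hO
    ⟨Z.pt, hpU, x, hxV, hx.symm⟩
  rw [h] at hw
  obtain rfl := Y.isEmbedding_incl.injective hw
  exact disjoint_left.1 hUV hyU hwV

theorem Below.trace_subset {Y Z : OnePointConnectification i X} (h : Y.Below Z)
    (C : Component X) : Z.trace C ⊆ Y.trace C := by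
  obtain ⟨f, hf, hfx⟩ := h
  have hp := Below.map_pt hf hfx
  intro q hq
  refine ClusterPt.mono hq (map_mono ?_)
  have : (fun c : C.1 => Y.incl c) = f ∘ fun c : C.1 => Z.incl c := funext fun c => (hfx c).symm
  rw [traceFilter, traceFilter, this, ← comap_comap]
  refine comap_mono (map_le_iff_le_comap.1 ?_)
  exact hp ▸ hf.tendsto Z.pt

variable [LocallyConnectedSpace X] [LocallyCompactSpace X]

/-- The one-point connectification with prescribed traces, in which the neighbourhoods of the
additional point are given by independent choices on the components. -/
def box [Nonempty X] (hX : i.IsT X) (b : ∀ C : Component X, Set (StoneCechRemainder C.1))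
    (hc : ∀ C, IsClosed (b C)) (hb : ∀ C, (b C).Nonempty) : OnePointConnectification i X where
  carrier := BoxExtension b
  incl := BoxExtension.incl b
  isEmbedding_incl := BoxExtension.isOpenEmbedding_incl.isEmbedding
  denseRange_incl := BoxExtension.denseRange_incl hb
  compl_range_incl := ⟨_, BoxExtension.compl_range_incl⟩
  connectedSpace := BoxExtension.connectedSpace hb
  isT := by
    have := hX.t35Space
    have := BoxExtension.t35Space hc
    exact hX.of_isOpenEmbedding BoxExtension.isOpenEmbedding_incl BoxExtension.compl_range_incl

variable [Nonempty X] {hX : i.IsT X} {b : ∀ C : Component X, Set (StoneCechRemainder C.1)}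
    {hc : ∀ C, IsClosed (b C)} {hb : ∀ C, (b C).Nonempty}

theorem pt_box : (box hX b hc hb).pt = BoxExtension.pt b := by
  have h := (box hX b hc hb).compl_range_incl_eq
  exact (singleton_injective (BoxExtension.compl_range_incl.symm.trans h)).symm

theorem trace_box (C : Component X) : (box hX b hc hb).trace C = b C := by
  have := hX.t35Space
  refine Subset.antisymm (fun q hq => ?_) fun q hq => ?_
  · by_contra hqb
    have hd : Disjoint ({q.1} : Set (StoneCech C.1)) (Subtype.val '' b C) := by
      rw [disjoint_singleton_left]
      rintro ⟨q', hq', h⟩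
      exact hqb (Subtype.ext h ▸ hq')
    obtain ⟨U, W, hU, hW, hqU, hbW, hUW⟩ := normal_separation isClosed_singleton
      (BoxExtension.isClosed_image_val C (hc C)) hd
    -- `V` imposes `W` on `C` and no condition elsewhere, which the independence of the choices
    -- allows.
    let V : Set X := {x | ∀ h : x ∈ C.1, stoneCechUnit (⟨x, h⟩ : C.1) ∈ W}
    have hV : IsOpen V := by
      have : V = C.1ᶜ ∪ Subtype.val '' ((stoneCechUnit : C.1 → _) ⁻¹' W) := by
        ext x
        by_cases hx : x ∈ C.1 <;> simp [V, hx]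
      rw [this]
      exact C.isClosed.isOpen_compl.union
        (C.isOpen.isOpenMap_subtype_val _ (hW.preimage continuous_stoneCechUnit))
    have hN : IsBoxNhd b V := by
      intro D
      by_cases hD : D = C
      · subst hD
        exact ⟨W, hW, fun q hq => hbW ⟨q, hq, rfl⟩, fun c hcW _ => hcW⟩
      · refine ⟨univ, isOpen_univ, fun _ _ => trivial, fun c _ h => ?_⟩
        exact absurd ((Component.eq_of_mem c.2).symm.trans (Component.eq_of_mem h)) hD
    have hmem : insert (BoxExtension.pt b) (BoxExtension.incl b '' V) ∈
        𝓝 (box hX b hc hb).pt := by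
      rw [pt_box]
      exact (BoxExtension.isOpen_insert_pt hV hN).mem_nhds (mem_insert _ _)
    have hW' : W ∈ map stoneCechUnit ((box hX b hc hb).traceFilter C) := by
      refine ⟨_, hmem, ?_⟩
      rintro c (hcp | ⟨x, hx, hxc⟩)
      · exact absurd hcp (BoxExtension.incl_ne_pt _)
      · obtain rfl := BoxExtension.incl_injective hxc
        exact hx c.2
    obtain ⟨w, hwU, hwW⟩ := clusterPt_iff_nonempty.1 hq (hU.mem_nhds (hqU rfl)) hW'
    exact disjoint_left.1 hUW hwU hwW
  · refine clusterPt_iff_nonempty.2 fun {U} hU {T} hT => ?_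
    obtain ⟨V, hV, hVT⟩ := hT
    rw [pt_box] at hV
    obtain ⟨V', hV'V, hV'o, hp⟩ := mem_nhds_iff.1 hV
    obtain ⟨W, hW, hbW, hWV⟩ := hV'o.2 hp C
    obtain ⟨U', hU'U, hU'o, hqU'⟩ := mem_nhds_iff.1 hU
    obtain ⟨c, hcU, hcW⟩ := denseRange_stoneCechUnit.exists_mem_open (hU'o.inter hW)
      ⟨q.1, hqU', hbW q hq⟩
    exact ⟨_, hU'U hcU, hVT (hV'V (hWV c hcW))⟩

/-- Let `g` be `0` at the added point and `1` off `V`. The extension of `g` from `C` to `βC`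
vanishes on the trace, so the set where it is not `1` is a neighbourhood of `b C` whose points in
`C` lie in `V`. -/
theorem below_box_of_subset_trace {Z : OnePointConnectification i X}
    (h : ∀ C, b C ⊆ Z.trace C) : Z.Below (box hX b hc hb) := by
  let f : BoxExtension b → Z.carrier := fun z => Option.elim z Z.pt Z.incl
  refine ⟨f, ⟨fun V hV => BoxExtension.isOpen_iff.2
    ⟨hV.preimage Z.isEmbedding_incl.continuous, fun hp C => ?_⟩⟩, fun _ => rfl⟩
  have : T35Space Z.carrier := Z.isT.t35Space
  obtain ⟨g, hg, hg0, hg1⟩ := CompletelyRegularSpace.completely_regular_isOpen Z.pt V hV hp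
  have hgC : Continuous fun c : C.1 => g (Z.incl c) :=
    hg.comp (Z.isEmbedding_incl.continuous.comp continuous_subtype_val)
  have hext := continuous_stoneCechExtend hgC
  refine ⟨stoneCechExtend hgC ⁻¹' {1}ᶜ, isOpen_compl_singleton.preimage hext, fun q hq => ?_,
    fun c hcW => ?_⟩
  · have hq' : ClusterPt q.1 (map stoneCechUnit (Z.traceFilter C)) := h C hq
    have hlim : Tendsto (stoneCechExtend hgC) (map stoneCechUnit (Z.traceFilter C))
        (𝓝 (g Z.pt)) := by
      rw [tendsto_map'_iff, stoneCechExtend_extends]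
      exact (hg.tendsto Z.pt).comp tendsto_comap
    have hq0 : stoneCechExtend hgC q.1 = g Z.pt :=
      eq_of_nhds_neBot (hq'.map hext.continuousAt hlim)
    rw [mem_preimage, hq0, hg0]
    exact zero_ne_one
  · rw [mem_preimage, stoneCechExtend_stoneCechUnit] at hcW
    by_contra hcV
    exact hcW (hg1 hcV)

theorem below_box_iff {Z : OnePointConnectification i X} :
    Z.Below (box hX b hc hb) ↔ ∀ C, b C ⊆ Z.trace C :=
  ⟨fun h C => trace_box (hX := hX) (hc := hc) (hb := hb) C ▸ h.trace_subset C,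
    below_box_of_subset_trace⟩

end OnePointConnectification

/-! ### Maximal elements and closed boxes -/

namespace ConnectificationPoset

open OnePointConnectification

variable {i : SepIndex} {X : Type u} [TopologicalSpace X]

/-- The class of a one-point connectification. -/
def mk (Z : OnePointConnectification i X) : ConnectificationPoset i X := Quotient.mk _ Z

theorem mk_le_mk {Y Z : OnePointConnectification i X} : mk Y ≤ mk Z ↔ Y.Below Z := Iff.rfl

theorem exists_mk (p : ConnectificationPoset i X) : ∃ Z, mk Z = p := Quotient.exists_rep p

variable [LocallyConnectedSpace X] [LocallyCompactSpace X] [Nonempty X]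

/-- The maximal one-point connectification given by the choice of a point in the Stone–Čech
remainder of every component. -/
def ofPoints (hX : i.IsT X) (x : ∀ C : Component X, StoneCechRemainder C.1) :
    ConnectificationPoset i X :=
  mk (box hX (fun C => {x C}) (fun _ => isClosed_singleton) fun _ => singleton_nonempty _)

theorem mk_le_ofPoints {hX : i.IsT X} {x : ∀ C : Component X, StoneCechRemainder C.1}
    {Z : OnePointConnectification i X} : mk Z ≤ ofPoints hX x ↔ x ∈ univ.pi Z.trace := by
  rw [ofPoints, mk_le_mk, below_box_iff]
  simp

/-- Traces shrink as the connectification grows, but stay nonempty, so singletons cannot shrink. -/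
theorem ofPoints_le_mk {hX : i.IsT X} {x : ∀ C : Component X, StoneCechRemainder C.1}
    {Z : OnePointConnectification i X} (h : ofPoints hX x ≤ mk Z) : mk Z ≤ ofPoints hX x := by
  have := hX.t35Space
  rw [mk_le_ofPoints]
  intro C _
  obtain ⟨q, hq⟩ := Z.trace_nonempty C
  have := (mk_le_mk.1 h).trace_subset C hq
  rw [trace_box] at this
  exact this ▸ hq

theorem isBoxCoordinates_ofPoints (hX : i.IsT X) :
    IsBoxCoordinates (ofPoints hX : (∀ C : Component X, StoneCechRemainder C.1) → _) where
  injective x y h := by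
    have := mk_le_ofPoints.1 h.le
    funext C
    have := this C (mem_univ C)
    rw [trace_box] at this
    exact this.symm
  isMax_iff p := by
    have := hX.t35Space
    constructor
    · intro hp
      obtain ⟨Z, rfl⟩ := exists_mk p
      choose x hx using Z.trace_nonempty
      have hle : mk Z ≤ ofPoints hX x := mk_le_ofPoints.2 fun C _ => hx C
      exact ⟨x, (hp.eq_of_le hle).symm⟩
    · rintro ⟨x, rfl⟩ q hq
      obtain ⟨Z, rfl⟩ := exists_mk q
      exact ofPoints_le_mk hq
  isClosedBox_iff A := by
    have := hX.t35Space
    constructor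
    · rintro ⟨b, hb, rfl⟩
      refine ⟨mk (box hX b (fun C => (hb C).1) fun C => (hb C).2), ?_⟩
      ext x
      rw [mem_ofPred_eq, mk_le_ofPoints]
      simp [trace_box]
    · rintro ⟨p, rfl⟩
      obtain ⟨Z, rfl⟩ := exists_mk p
      refine ⟨Z.trace, fun C => ⟨Z.isClosed_trace C, Z.trace_nonempty C⟩, ?_⟩
      ext x
      rw [mem_ofPred_eq, mk_le_ofPoints]

end ConnectificationPoset

/-- This isolates the degenerate case: the empty space is not dense in a connected space, which is
nonempty, so it has no connectification. -/
theorem ConnectificationPoset.nonempty_iff {i : SepIndex} {X : Type u} [TopologicalSpace X]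
    [LocallyConnectedSpace X] [LocallyCompactSpace X] (hX : i.IsT X)
    (hc : ∀ C : Component X, Nontrivial (StoneCechRemainder C.1)) :
    Nonempty (ConnectificationPoset i X) ↔ Nonempty X := by
  constructor
  · rintro ⟨p⟩
    obtain ⟨Z, -⟩ := exists_mk p
    have := Z.connectedSpace
    exact Z.denseRange_incl.nonempty_iff.2 inferInstance
  · intro h
    exact ⟨ofPoints hX fun C => Classical.arbitrary _⟩

theorem nontrivial_of_three_le_mk {T : Type*} (h : 3 ≤ Cardinal.mk T) : Nontrivial T :=
  Cardinal.one_lt_iff_nontrivial.1 (lt_of_lt_of_le (by norm_num) h)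

theorem theorem3p3 (i : SepIndex)
    {X : Type u} [TopologicalSpace X] [LocallyConnectedSpace X] [LocallyCompactSpace X]
    {Y : Type v} [TopologicalSpace Y] [LocallyConnectedSpace Y] [LocallyCompactSpace Y]
    (hX : i.IsT X) (hY : i.IsT Y)
    (hcX : ∀ C : Component X, 3 ≤ Cardinal.mk (StoneCechRemainder C.1))
    (hcY : ∀ D : Component Y, 3 ≤ Cardinal.mk (StoneCechRemainder D.1))
    (φ : ConnectificationPoset i X ≃o ConnectificationPoset i Y) :
    ∃ ψ : Component X ≃ Component Y, ∀ C : Component X,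
      Nonempty (StoneCechRemainder C.1 ≃ₜ StoneCechRemainder (ψ C).1) := by
  have hnX := fun C => nontrivial_of_three_le_mk (hcX C)
  have hnY := fun D => nontrivial_of_three_le_mk (hcY D)
  have hXY : Nonempty X ↔ Nonempty Y := by
    rw [← ConnectificationPoset.nonempty_iff hX hnX, ← ConnectificationPoset.nonempty_iff hY hnY]
    exact φ.toEquiv.nonempty_congr
  rcases isEmpty_or_nonempty X with h | h
  · have hY' : IsEmpty Y := not_nonempty_iff.1 fun h' => not_isEmpty_iff.2 (hXY.2 h') h
    have : IsEmpty (Component X) := ⟨fun C => h.false C.2.choose⟩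
    have : IsEmpty (Component Y) := ⟨fun D => hY'.false D.2.choose⟩
    exact ⟨Equiv.equivOfIsEmpty _ _, fun C => isEmptyElim C⟩
  · have := hXY.1 h
    exact (ConnectificationPoset.isBoxCoordinates_ofPoints hX).exists_equiv_homeomorph
      (ConnectificationPoset.isBoxCoordinates_ofPoints hY) φ
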